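/- For a positive integer $N$ and a set $D$ of proper divisors of $N$ (divisors $d$ with $1\le d<N$), let $\mathrm{ICG}_N(D)$ be the graph with vertex set $\mathbb{Z}/N\mathbb{Z}$ in which $x$ and $y$ are adjacent if and only if $x\neq y$ and $\gcd(x-y,N)\in D$. For a graph $G$ and $m\ge 1$, let $G^{+m}$ be the $m$-fold self-join of $G$: take $m$ disjoint copies of $G$ and join every two vertices that lie in different copies by an edge. A finite simple graph with adjacency matrix $A$ has perfect state transfer between its vertices $u$ and $v$ if there is a real $t$ with $|(e^{-itA})_{v,u}|=|(e^{-itA})_{u,v}|=1$. Let $m\ge 1$, let $n$ be a positive integer with $n\equiv 0\pmod 8$, let $b\in\{1,2\}$, and let $Q$ be a (possibly empty) set of odd divisors of $n$. (1) If $G=\mathrm{ICG}_n(\{1,n/2^b\})$, then $G^{+m}$ has perfect state transfer between the vertices $0$ and $n/2$ in each copy of $G$. (2) If $G=\mathrm{ICG}_{2n}(\{2,n/2^{b-1}\}\cup Q)$, then $G^{+m}$ has perfect state transfer between the vertices $0$ and $n\in\mathbb{Z}/2n\mathbb{Z}$ in each copy of $G$. -/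

import Mathlib

/-- The set `G_n(d) = {k : gcd(n, k) = d, 1 ≤ k < n}`, as a set of residues modulo `n`
(each residue being identified with its representative in `{0, …, n - 1}`). -/
def gcdResidues (n d : ℕ) : Set (ZMod n) :=
  {k | 1 ≤ k.val ∧ Nat.gcd n k.val = d}

/-- The integral circulant graph `ICG_n(D)`: the circulant graph on `ℤ/nℤ` whose set of edge
distances is the union of the sets `G_n(d)`, `d ∈ D`. -/
def integralCirculant (n : ℕ) (D : Finset ℕ) : SimpleGraph (ZMod n) :=
  SimpleGraph.circulantGraph (⋃ d ∈ D, gcdResidues n d)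

/-- The `m`-fold self-join `G^{+m}`: take `m` copies of `G` (the vertex `(j, v)` is the vertex `v`
of the `j`-th copy) and connect all vertices that lie in different copies. -/
def selfJoin {V : Type*} (G : SimpleGraph V) (m : ℕ) : SimpleGraph (Fin m × V) where
  Adj x y := x.1 ≠ y.1 ∨ (x.1 = y.1 ∧ G.Adj x.2 y.2)
  symm := ⟨by
    rintro x y (h | ⟨h, h'⟩)
    · exact Or.inl h.symm
    · exact Or.inr ⟨h.symm, h'.symm⟩⟩
  loopless := ⟨by
    rintro x (h | ⟨_, h⟩)
    · exact h rfl
    · exact G.irrefl h⟩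

open Classical in
/-- The continuous-time quantum walk operator `e^{-itA}` of a finite graph `G` with adjacency
matrix `A`. -/
noncomputable def quantumWalk {V : Type*} [Fintype V] [DecidableEq V] (G : SimpleGraph V)
    (t : ℝ) : Matrix V V ℂ :=
  NormedSpace.exp ((-(Complex.I * (t : ℂ))) • G.adjMatrix ℂ)

/-- Perfect state transfer from `a` to `b` at time `t`: `|⟨b| e^{-itA} |a⟩| = 1`. -/
def PerfectStateTransferAt {V : Type*} [Fintype V] [DecidableEq V] (G : SimpleGraph V)
    (a b : V) (t : ℝ) : Prop :=
  ‖quantumWalk G t b a‖ = 1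

/-- Perfect state transfer between `a` and `b`: at some time there is perfect state transfer
from `a` to `b` and from `b` to `a`. -/
def PerfectStateTransferBetween {V : Type*} [Fintype V] [DecidableEq V] (G : SimpleGraph V)
    (a b : V) : Prop :=
  ∃ t : ℝ, PerfectStateTransferAt G a b t ∧ PerfectStateTransferAt G b a t

/-! Transfer happens at time `π / 2`. On the group `ℤ/m × ℤ/N` the adjacency matrix of the self-join
is an integer combination of circulants `J_S` of subgroups `S`: the whole group minus one layer
gives the join edges, and Möbius inversion expands each condition `gcd(N, x) = d` into the subgroups
`(d * e)` of a layer, `e ∣ N / d`. Circulants commute, so the walk is a product of factors `exp(-iπk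
J_S / 2)`. Since `J_S² = |S| J_S`, a factor is trivial as soon as `4 ∣ k|S|`. If `8 * d ∣ N`, every
term has this property, because a squarefree `e` absorbs at most one factor 2. For `d = N / 2` or `N
/ 4` there remains, up to a phase, the factor of the subgroup of order 2. It equals `1 - J_S`, which
is minus the translation by `N / 2`. -/

theorem exp_smul_of_mul_self_eq_smul {ι : Type*} [Fintype ι] [DecidableEq ι] {L : Matrix ι ι ℂ}
    {r : ℂ} (hr : r ≠ 0) (hL : L * L = r • L) (z : ℂ) :
    NormedSpace.exp (z • L) = 1 + ((Complex.exp (z * r) - 1) / r) • L := by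
  let _ : NormedRing (Matrix ι ι ℂ) := Matrix.linftyOpNormedRing
  let _ : NormedAlgebra ℂ (Matrix ι ι ℂ) := Matrix.linftyOpNormedAlgebra
  have hpow : ∀ k : ℕ, L ^ (k + 1) = r ^ k • L := by
    intro k
    induction k with
    | zero => simp
    | succ k ih => rw [pow_succ, ih, Matrix.smul_mul, hL, smul_smul, pow_succ]
  have h1 : HasSum (fun k : ℕ => ((k.factorial : ℂ)⁻¹) • (z • L) ^ k) (NormedSpace.exp (z • L)) :=
    NormedSpace.exp_series_hasSum_exp' (𝕂 := ℂ) (z • L)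
  have h2 : HasSum (fun k : ℕ => ((k.factorial : ℂ)⁻¹) • (z * r) ^ k) (Complex.exp (z * r)) := by
    rw [Complex.exp_eq_exp_ℂ]
    exact NormedSpace.exp_series_hasSum_exp' (𝕂 := ℂ) (z * r)
  -- Since `L ^ (k + 1) = r ^ k • L`, the series of `exp (z * r)` times `r⁻¹ • L` is correct in
  -- every degree except 0; `h4` repairs that term.
  have h3 : HasSum (fun k : ℕ => (((k.factorial : ℂ)⁻¹) • (z * r) ^ k) • (r⁻¹ • L))
      (Complex.exp (z * r) • (r⁻¹ • L)) := h2.smul_const _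
  have h4 : HasSum (fun k : ℕ => if k = 0 then 1 - r⁻¹ • L else 0) (1 - r⁻¹ • L) :=
    hasSum_ite_eq 0 _
  have h5 := h3.add h4
  have h6 : (fun k : ℕ => ((k.factorial : ℂ)⁻¹) • (z • L) ^ k) = fun k : ℕ =>
      (((k.factorial : ℂ)⁻¹) • (z * r) ^ k) • (r⁻¹ • L) + if k = 0 then 1 - r⁻¹ • L else 0 := by
    funext k
    rcases k with _ | k
    · simp
    · rw [smul_pow, hpow]
      simp only [smul_smul, smul_eq_mul, Nat.add_eq_zero_iff, one_ne_zero, and_false, if_false,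
        add_zero]
      congr 1
      rw [mul_pow, pow_succ r k]
      field_simp
  rw [h6] at h1
  rw [h1.unique h5, div_eq_mul_inv, sub_mul, sub_smul, smul_smul, one_mul]
  abel

/-- The complex indicator function of a subgroup. -/
noncomputable def subgroupIndicator {Γ : Type*} [AddCommGroup Γ] (S : AddSubgroup Γ) : Γ → ℂ :=
  (S : Set Γ).indicator 1

open Classical in
theorem subgroupIndicator_apply {Γ : Type*} [AddCommGroup Γ] (S : AddSubgroup Γ) (x : Γ) :
    subgroupIndicator S x = if x ∈ S then 1 else 0 := by
  simp [subgroupIndicator, Set.indicator_apply]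

/-! ### Walks of subgroup circulants at time `π / 2`. -/

section Circulant

variable {Γ : Type*} [Fintype Γ] [DecidableEq Γ] [AddCommGroup Γ]

/-- The quantum walk operator at time `π / 2` of the weighted circulant graph with weights `v`. -/
noncomputable def circulantWalk (v : Γ → ℂ) : Matrix Γ Γ ℂ :=
  NormedSpace.exp ((-(Complex.I * ((Real.pi / 2 : ℝ) : ℂ))) • Matrix.circulant v)

theorem circulantWalk_zero : circulantWalk (0 : Γ → ℂ) = 1 := by
  simp [circulantWalk]

theorem circulantWalk_add (v w : Γ → ℂ) :
    circulantWalk (v + w) = circulantWalk v * circulantWalk w := by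
  rw [circulantWalk, Matrix.circulant_add, smul_add, Matrix.exp_add_of_commute]
  · rfl
  · exact ((show Commute _ _ from Matrix.circulant_mul_comm v w).smul_left _).smul_right _

theorem circulantWalk_sum_eq_one {α : Type*} (s : Finset α) (f : α → Γ → ℂ)
    (h : ∀ a ∈ s, circulantWalk (f a) = 1) : circulantWalk (∑ a ∈ s, f a) = 1 := by
  classical
  induction s using Finset.induction_on with
  | empty => simpa using circulantWalk_zero
  | insert a s ha ih =>
    rw [Finset.sum_insert ha, circulantWalk_add, h a (Finset.mem_insert_self a s),
      ih fun b hb => h b (Finset.mem_insert_of_mem hb), one_mul]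

theorem circulant_subgroupIndicator_mul_self (S : AddSubgroup Γ) :
    Matrix.circulant (subgroupIndicator S) * Matrix.circulant (subgroupIndicator S) =
      (Nat.card S : ℂ) • Matrix.circulant (subgroupIndicator S) := by
  classical
  rw [Matrix.circulant_mul, ← Matrix.circulant_smul]
  congr 1
  funext x
  simp only [Matrix.mulVec, dotProduct, Matrix.circulant_apply, Pi.smul_apply, smul_eq_mul,
    subgroupIndicator_apply, mul_ite, mul_one, mul_zero]
  rw [← Finset.sum_filter]
  have h : ∀ k ∈ Finset.univ.filter (fun k => k ∈ S),
      (if x - k ∈ S then (1 : ℂ) else 0) = if x ∈ S then 1 else 0 := by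
    intro k hk
    have hk' : k ∈ S := by simpa using hk
    simp only [sub_eq_add_neg, S.add_mem_cancel_right (S.neg_mem hk')]
  rw [Finset.sum_congr rfl h, Finset.sum_const, nsmul_eq_mul, Nat.card_eq_fintype_card,
    Fintype.card_subtype]
  split_ifs <;> simp

theorem circulantWalk_smul_subgroupIndicator (k : ℂ) (S : AddSubgroup Γ) :
    circulantWalk (k • subgroupIndicator S) = 1 +
      ((Complex.exp (-(Complex.I * ((Real.pi / 2 : ℝ) : ℂ)) * k * (Nat.card S : ℂ)) - 1) /
        (Nat.card S : ℂ)) • Matrix.circulant (subgroupIndicator S) := by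
  rw [circulantWalk, Matrix.circulant_smul, smul_smul]
  exact exp_smul_of_mul_self_eq_smul (by exact_mod_cast Nat.card_pos.ne')
    (circulant_subgroupIndicator_mul_self S) _

theorem circulantWalk_smul_subgroupIndicator_eq_one {k : ℤ} {S : AddSubgroup Γ}
    (h : 4 ∣ k * (Nat.card S : ℤ)) :
    circulantWalk ((k : ℂ) • subgroupIndicator S) = 1 := by
  obtain ⟨c, hc⟩ := h
  have hc' : (k : ℂ) * (Nat.card S : ℂ) = 4 * c := by exact_mod_cast hc
  rw [circulantWalk_smul_subgroupIndicator, mul_assoc, hc']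
  have : -(Complex.I * ((Real.pi / 2 : ℝ) : ℂ)) * (4 * (c : ℂ)) =
      ((-c : ℤ) : ℂ) * (2 * Real.pi * Complex.I) := by
    push_cast
    ring
  rw [this, Complex.exp_int_mul_two_pi_mul_I]
  simp

/-- The exponential is `exp(-iπk) = -1`, so the coefficient is `-2 / 2`. This is the one factor that
moves vertices: the diagonal cancels, leaving minus a translation. -/
theorem circulantWalk_smul_subgroupIndicator_of_card_eq_two {k : ℤ} (hk : Odd k)
    {S : AddSubgroup Γ} (hS : Nat.card S = 2) :
    circulantWalk ((k : ℂ) • subgroupIndicator S) =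
      1 - Matrix.circulant (subgroupIndicator S) := by
  obtain ⟨c, rfl⟩ := hk
  rw [circulantWalk_smul_subgroupIndicator, hS]
  have : -(Complex.I * ((Real.pi / 2 : ℝ) : ℂ)) * ((2 * c + 1 : ℤ) : ℂ) * ((2 : ℕ) : ℂ) =
      ((-c - 1 : ℤ) : ℂ) * (2 * Real.pi * Complex.I) + Real.pi * Complex.I := by
    push_cast
    ring
  rw [this, Complex.exp_add, Complex.exp_int_mul_two_pi_mul_I, Complex.exp_pi_mul_I,
    show ((1 : ℂ) * -1 - 1) / ((2 : ℕ) : ℂ) = -1 by norm_num, neg_one_smul, sub_eq_add_neg]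

theorem circulantWalk_smul_subgroupIndicator_of_card_eq_one (k : ℤ)
    {S : AddSubgroup Γ} (hS : Nat.card S = 1) :
    ∃ c : ℂ, ‖c‖ = 1 ∧ circulantWalk ((k : ℂ) • subgroupIndicator S) = c • 1 := by
  refine ⟨Complex.exp ((-(Real.pi / 2 * k) : ℝ) * Complex.I), Complex.norm_exp_ofReal_mul_I _, ?_⟩
  obtain rfl := AddSubgroup.card_eq_one.mp hS
  have hI : Matrix.circulant (subgroupIndicator (⊥ : AddSubgroup Γ)) = 1 := by
    ext x y
    simp [Matrix.circulant_apply, subgroupIndicator_apply, Matrix.one_apply, sub_eq_zero]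
  rw [circulantWalk_smul_subgroupIndicator, hI, hS, Nat.cast_one, div_one, sub_smul, one_smul,
    mul_one]
  have : -(Complex.I * ((Real.pi / 2 : ℝ) : ℂ)) * (k : ℂ) =
      (-(Real.pi / 2 * k) : ℝ) * Complex.I := by
    push_cast
    ring
  rw [this]
  abel

end Circulant

/-! ### Möbius inversion for gcd classes. -/

theorem sum_moebius_divisors_eq_ite (g : ℕ) :
    ∑ e ∈ g.divisors, ArithmeticFunction.moebius e = if g = 1 then 1 else 0 := by
  rw [← ArithmeticFunction.coe_zeta_mul_apply, ArithmeticFunction.coe_zeta_mul_moebius,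
    ArithmeticFunction.one_apply]

theorem ZMod.mem_zmultiples_natCast_iff {N f : ℕ} [NeZero N] (hf : f ∣ N) (x : ZMod N) :
    x ∈ AddSubgroup.zmultiples (f : ZMod N) ↔ f ∣ x.val := by
  rw [AddSubgroup.mem_zmultiples_iff]
  constructor
  · rintro ⟨k, hk⟩
    have h : ((k * f : ℤ) : ZMod N) = ((x.val : ℤ) : ZMod N) := by
      simp [← hk]
    rw [ZMod.intCast_eq_intCast_iff_dvd_sub] at h
    have h2 : (f : ℤ) ∣ (x.val : ℤ) - k * f := (Int.natCast_dvd_natCast.mpr hf).trans h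
    exact Int.natCast_dvd_natCast.mp ((dvd_sub_left (Dvd.intro_left k rfl)).mp h2)
  · rintro ⟨c, hc⟩
    refine ⟨c, ?_⟩
    rw [← ZMod.natCast_zmod_val x, hc]
    push_cast
    rw [zsmul_eq_mul]
    push_cast
    ring

open Classical in
/-- Möbius inversion for the condition `gcd(N, x) = d`. -/
theorem ite_mem_gcdResidues_eq_sum {N d : ℕ} [NeZero N] (hd : d ∣ N) (hlt : d < N) (x : ZMod N) :
    (if x ∈ gcdResidues N d then (1 : ℤ) else 0) =
      ∑ e ∈ (N / d).divisors, ArithmeticFunction.moebius e *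
        if x ∈ AddSubgroup.zmultiples ((d * e : ℕ) : ZMod N) then 1 else 0 := by
  have hN : 0 < N := Nat.pos_of_neZero N
  have hdpos : 0 < d := Nat.pos_of_dvd_of_pos hd hN
  -- The residue 0 is excluded automatically, as `gcd(N, 0) = N ≠ d`.
  have hmem : x ∈ gcdResidues N d ↔ Nat.gcd N x.val = d := by
    refine ⟨fun h => h.2, fun h => ⟨?_, h⟩⟩
    by_contra h0
    have : x.val = 0 := by omega
    rw [this, Nat.gcd_zero_right] at h
    omega
  have hdiv : ∀ e ∈ (N / d).divisors, d * e ∣ N := fun e he => by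
    have := Nat.mul_dvd_mul_left d (Nat.dvd_of_mem_divisors he)
    rwa [Nat.mul_div_cancel' hd] at this
  simp only [mul_ite, mul_one, mul_zero]
  rw [Finset.sum_congr rfl fun e he => if_congr
    (ZMod.mem_zmultiples_natCast_iff (hdiv e he) x) rfl rfl, ← Finset.sum_filter]
  by_cases hx : d ∣ x.val
  · obtain ⟨g, hg⟩ := Nat.dvd_gcd hd hx
    have hgpos : 0 < Nat.gcd N x.val := Nat.gcd_pos_of_pos_left _ hN
    have hgne : g ≠ 0 := by
      rintro rfl
      omega
    -- With `gcd(N, x) = d * g`, the surviving `e` are the divisors of `g`, so the Möbius sum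
    -- detects `g = 1`.
    have hset : (N / d).divisors.filter (fun e => d * e ∣ x.val) = g.divisors := by
      ext e
      simp only [Finset.mem_filter, Nat.mem_divisors]
      constructor
      · rintro ⟨⟨he, hne⟩, hex⟩
        refine ⟨?_, hgne⟩
        have : d * e ∣ Nat.gcd N x.val :=
          Nat.dvd_gcd (hdiv e (Nat.mem_divisors.mpr ⟨he, hne⟩)) hex
        rw [hg] at this
        exact Nat.dvd_of_mul_dvd_mul_left hdpos this
      · rintro ⟨he, -⟩
        have hde : d * e ∣ Nat.gcd N x.val := hg ▸ Nat.mul_dvd_mul_left d he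
        refine ⟨⟨?_, (Nat.div_pos hlt.le hdpos).ne'⟩, hde.trans (Nat.gcd_dvd_right _ _)⟩
        exact Nat.dvd_div_of_mul_dvd (hde.trans (Nat.gcd_dvd_left _ _))
    rw [hset, sum_moebius_divisors_eq_ite, hmem, hg]
    simp [hdpos.ne']
  · have h1 : ¬ x ∈ gcdResidues N d := fun h => hx (hmem.mp h ▸ Nat.gcd_dvd_right _ _)
    rw [if_neg h1, Finset.filter_false_of_mem, Finset.sum_empty]
    exact fun e _ he => hx ((Dvd.intro e rfl).trans he)

theorem neg_mem_gcdResidues_iff {N d : ℕ} [NeZero N] (x : ZMod N) :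
    -x ∈ gcdResidues N d ↔ x ∈ gcdResidues N d := by
  suffices h : ∀ y : ZMod N, y ∈ gcdResidues N d → -y ∈ gcdResidues N d from
    ⟨fun hx => neg_neg x ▸ h _ hx, h x⟩
  rintro y ⟨h1, h2⟩
  have hy : y ≠ 0 := by
    rintro rfl
    simp at h1
  have hlt := ZMod.val_lt y
  rw [gcdResidues, Set.mem_ofPred_eq, ZMod.neg_val, if_neg hy]
  refine ⟨by omega, ?_⟩
  rw [Nat.gcd_self_sub_right hlt.le, h2]

/-! ### Decomposition of the self-join over `ℤ/m × ℤ/N`. -/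

section Layer

variable {m N : ℕ} [NeZero m] [NeZero N]

/-- The multiples of `f` inside the zeroth copy of `ℤ/Nℤ` in `ℤ/mℤ × ℤ/Nℤ`. -/
def layerMultiples (m N f : ℕ) [NeZero m] : AddSubgroup (Fin m × ZMod N) :=
  AddSubgroup.prod ⊥ (AddSubgroup.zmultiples (f : ZMod N))

theorem mem_layerMultiples {f : ℕ} (p : Fin m × ZMod N) :
    p ∈ layerMultiples m N f ↔ p.1 = 0 ∧ p.2 ∈ AddSubgroup.zmultiples (f : ZMod N) := by
  simp [layerMultiples, AddSubgroup.mem_prod]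

theorem card_layerMultiples {f : ℕ} (hf : f ∣ N) : Nat.card (layerMultiples m N f) = N / f := by
  rw [layerMultiples, Nat.card_congr (AddSubgroup.prodEquiv _ _).toEquiv, Nat.card_prod,
    Nat.card_zmultiples, ZMod.addOrderOf_coe _ (NeZero.ne N), Nat.gcd_eq_right hf]
  simp

open Classical in
/-- The indicator function of `gcdResidues N d` inside the zeroth copy. -/
noncomputable def layerGcdIndicator (m N d : ℕ) [NeZero m] : Fin m × ZMod N → ℂ :=
  fun p => if p.1 = 0 ∧ p.2 ∈ gcdResidues N d then 1 else 0

theorem layerGcdIndicator_eq_sum {d : ℕ} (hd : d ∣ N) (hlt : d < N) :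
    layerGcdIndicator m N d = ∑ e ∈ (N / d).divisors,
      ((ArithmeticFunction.moebius e : ℤ) : ℂ) • subgroupIndicator (layerMultiples m N (d * e)) := by
  classical
  funext p
  simp only [layerGcdIndicator, Finset.sum_apply, Pi.smul_apply, smul_eq_mul,
    subgroupIndicator_apply, mem_layerMultiples]
  by_cases hp : p.1 = 0
  · have := congrArg (Int.cast : ℤ → ℂ) (ite_mem_gcdResidues_eq_sum hd hlt p.2)
    push_cast at this
    simpa [hp] using this
  · simp [hp]

theorem circulantWalk_layerGcdIndicator_eq_one {d : ℕ} (hd : 8 * d ∣ N) :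
    circulantWalk (layerGcdIndicator m N d) = 1 := by
  have hN : 0 < N := Nat.pos_of_neZero N
  obtain ⟨c, hc⟩ := hd
  have hdpos : 0 < d := Nat.pos_of_ne_zero (by rintro rfl; omega)
  have hcpos : 0 < c := Nat.pos_of_ne_zero (by rintro rfl; omega)
  have hNd : N = d * (8 * c) := by rw [hc]; ring
  have hdN : d ∣ N := ⟨_, hNd⟩
  have hdiv : N / d = 8 * c := by rw [hNd, Nat.mul_div_cancel_left _ hdpos]
  have hlt : d < N := by nlinarith
  rw [layerGcdIndicator_eq_sum hdN hlt]
  refine circulantWalk_sum_eq_one _ _ fun e he => ?_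
  apply circulantWalk_smul_subgroupIndicator_eq_one
  rw [hdiv] at he
  obtain ⟨f, hf⟩ := Nat.dvd_of_mem_divisors he
  have hepos : 0 < e := Nat.pos_of_mem_divisors he
  have hNe : N = d * e * f := by rw [hNd, hf]; ring
  rw [card_layerMultiples ⟨f, hNe⟩, hNe, Nat.mul_div_cancel_left _ (by positivity)]
  by_cases hsq : Squarefree e
  · apply Dvd.dvd.mul_left
    -- From `8 ∣ e * f` and `4 ∤ e` it follows that `4 ∣ f`, where `f` is the order of the subgroup.
    have h4 : ¬ 4 ∣ e := fun h => by
      have := Nat.isUnit_iff.mp (hsq 2 (by simpa using h))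
      omega
    have h4f : 4 ∣ f := by
      have h8 : 8 ∣ e * f := ⟨c, hf.symm⟩
      by_cases h2 : 2 ∣ e
      · obtain ⟨e', rfl⟩ := h2
        have : Nat.Coprime 4 e' := by
          rw [show 4 = 2 ^ 2 from rfl]
          apply Nat.Coprime.pow_left
          rw [Nat.prime_two.coprime_iff_not_dvd]
          exact fun h => h4 (Nat.mul_dvd_mul_left 2 h)
        refine this.dvd_of_dvd_mul_left (Nat.dvd_of_mul_dvd_mul_left (by norm_num : 0 < 2) ?_)
        rwa [← mul_assoc]
      · have : Nat.Coprime (2 ^ 2) e :=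
          Nat.Coprime.pow_left _ (Nat.prime_two.coprime_iff_not_dvd.mpr h2)
        exact this.dvd_of_dvd_mul_left ((by norm_num : 2 ^ 2 ∣ 8).trans h8)
    exact_mod_cast h4f
  · simp [ArithmeticFunction.moebius_eq_zero_of_not_squarefree hsq]

/-- For `N = 2 * d` the subgroups have orders 2 and 1, the latter giving the phase `c`. For `N = 4 *
d` the orders are 4, 2, 1: order 4 is trivial and order 1 drops out because `μ(4) = 0`. -/
theorem circulantWalk_layerGcdIndicator_eq_smul {d : ℕ} (hd : N = 2 * d ∨ N = 4 * d)
    (hN : 2 ∣ N) : ∃ c : ℂ, ‖c‖ = 1 ∧ circulantWalk (layerGcdIndicator m N d) =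
      c • (1 - Matrix.circulant (subgroupIndicator (layerMultiples m N (N / 2)))) := by
  have hpos : 0 < N := Nat.pos_of_neZero N
  have hdpos : 0 < d := by omega
  have hdN : d ∣ N := by
    rcases hd with h | h <;> exact ⟨_, h.trans (mul_comm _ _)⟩
  have hhalf : Nat.card (layerMultiples m N (N / 2)) = 2 := by
    rw [card_layerMultiples (Nat.div_dvd_of_dvd hN), Nat.div_div_self hN hpos.ne']
  rw [layerGcdIndicator_eq_sum hdN (by omega)]
  rcases hd with h | h
  · have hM : N / d = 2 := by rw [h, Nat.mul_div_cancel _ hdpos]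
    have hd2 : d = N / 2 := by omega
    have hcard : Nat.card (layerMultiples m N (d * 2)) = 1 := by
      rw [card_layerMultiples ⟨1, by omega⟩, show d * 2 = N by omega, Nat.div_self hpos]
    obtain ⟨c, hc, hW⟩ := circulantWalk_smul_subgroupIndicator_of_card_eq_one
      (ArithmeticFunction.moebius 2) hcard
    refine ⟨c, hc, ?_⟩
    rw [hM, show Nat.divisors 2 = {1, 2} from rfl, Finset.sum_pair (by norm_num),
      circulantWalk_add, hW, mul_one, hd2,
      circulantWalk_smul_subgroupIndicator_of_card_eq_two (by simp) hhalf]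
    simp
  · have hM : N / d = 4 := by rw [h, Nat.mul_div_cancel _ hdpos]
    have hd2 : d * 2 = N / 2 := by omega
    have hcard : Nat.card (layerMultiples m N (d * 1)) = 4 := by
      rw [mul_one, card_layerMultiples hdN, hM]
    have h4 : ArithmeticFunction.moebius 4 = 0 :=
      ArithmeticFunction.moebius_eq_zero_of_not_squarefree (by decide)
    refine ⟨1, norm_one, ?_⟩
    rw [hM, show Nat.divisors 4 = {1, 2, 4} from rfl, Finset.sum_insert (by decide),
      Finset.sum_pair (by norm_num), circulantWalk_add, circulantWalk_add, h4, hd2,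
      circulantWalk_smul_subgroupIndicator_eq_one (by rw [hcard]; simp),
      circulantWalk_smul_subgroupIndicator_of_card_eq_two
        (by simp [ArithmeticFunction.moebius_apply_prime Nat.prime_two]) hhalf]
    simp [circulantWalk_zero]

open Classical in
theorem adjMatrix_selfJoin_integralCirculant (D : Finset ℕ) :
    (selfJoin (integralCirculant N D) m).adjMatrix ℂ = Matrix.circulant
      ((((1 : ℤ) : ℂ) • subgroupIndicator (⊤ : AddSubgroup (Fin m × ZMod N)) +
        ((-1 : ℤ) : ℂ) • subgroupIndicator (layerMultiples m N 1)) +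
          ∑ d ∈ D, layerGcdIndicator m N d) := by
  ext ⟨i, x⟩ ⟨j, y⟩
  have hadj : (integralCirculant N D).Adj x y ↔ ∃ d ∈ D, x - y ∈ gcdResidues N d := by
    have hsymm : ∀ d, y - x ∈ gcdResidues N d ↔ x - y ∈ gcdResidues N d := fun d => by
      rw [← neg_sub, neg_mem_gcdResidues_iff]
    rw [integralCirculant, SimpleGraph.circulantGraph_adj]
    simp only [Set.mem_iUnion, hsymm, or_self, exists_prop]
    refine ⟨fun h => h.2, fun h => ⟨?_, h⟩⟩
    rintro rfl
    obtain ⟨d, -, h1, -⟩ := h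
    simp at h1
  have hjoin : (selfJoin (integralCirculant N D) m).Adj (i, x) (j, y) ↔
      i ≠ j ∨ i = j ∧ ∃ d ∈ D, x - y ∈ gcdResidues N d :=
    or_congr_right (and_congr_right' hadj)
  have hone : x - y ∈ AddSubgroup.zmultiples ((1 : ℕ) : ZMod N) := by
    rw [ZMod.mem_zmultiples_natCast_iff (one_dvd N)]
    exact one_dvd _
  have hsum : (∑ d ∈ D, if x - y ∈ gcdResidues N d then (1 : ℂ) else 0) =
      if ∃ d ∈ D, x - y ∈ gcdResidues N d then 1 else 0 := by
    split_ifs with h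
    · obtain ⟨d, hd, hx⟩ := h
      -- The gcd determines `d`, so the classes are disjoint and at most one summand is nonzero.
      rw [Finset.sum_eq_single_of_mem d hd fun e _ hne => if_neg fun he =>
        hne (he.2.symm.trans hx.2), if_pos hx]
    · exact Finset.sum_eq_zero fun d hd => if_neg fun hx => h ⟨d, hd, hx⟩
  simp only [SimpleGraph.adjMatrix_apply, hjoin, Matrix.circulant_apply, Pi.add_apply,
    Pi.smul_apply, Finset.sum_apply, subgroupIndicator_apply, mem_layerMultiples,
    layerGcdIndicator, AddSubgroup.mem_top, Prod.mk_sub_mk, sub_eq_zero, hone]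
  by_cases hij : i = j
  · simp [hij, hsum]
  · simp [hij]

/-- The two subgroups have orders `m * N` and `N`, both divisible by 4, so the join edges do not
affect the walk. -/
theorem circulantWalk_complement_layers_eq_one (hN : 4 ∣ N) :
    circulantWalk (((1 : ℤ) : ℂ) • subgroupIndicator (⊤ : AddSubgroup (Fin m × ZMod N)) +
        ((-1 : ℤ) : ℂ) • subgroupIndicator (layerMultiples m N 1)) = 1 := by
  have h4 : (4 : ℤ) ∣ (N : ℤ) := by exact_mod_cast hN
  rw [circulantWalk_add, circulantWalk_smul_subgroupIndicator_eq_one,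
    circulantWalk_smul_subgroupIndicator_eq_one, one_mul]
  · rw [card_layerMultiples (one_dvd N), Nat.div_one]
    exact h4.mul_left _
  · rw [AddSubgroup.card_top, Nat.card_prod, Nat.card_zmod, one_mul]
    push_cast
    exact h4.mul_left _

end Layer

/-! ### Perfect state transfer. -/

theorem perfectStateTransferBetween_selfJoin_integralCirculant {m N : ℕ} [NeZero N] (hN : 8 ∣ N)
    {D : Finset ℕ} {d₀ : ℕ} (hd₀ : d₀ ∈ D) (hd₀N : N = 2 * d₀ ∨ N = 4 * d₀)
    (hD : ∀ d ∈ D, d ≠ d₀ → 8 * d ∣ N) (j : Fin m) :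
    PerfectStateTransferBetween (selfJoin (integralCirculant N D) m)
      (j, 0) (j, ((N / 2 : ℕ) : ZMod N)) := by
  classical
  have : NeZero m := ⟨by rintro rfl; exact j.elim0⟩
  have hpos : 0 < N := Nat.pos_of_neZero N
  obtain ⟨c, hc, hW⟩ := circulantWalk_layerGcdIndicator_eq_smul (m := m) hd₀N
    ((by norm_num : 2 ∣ 8).trans hN)
  have hwalk : quantumWalk (selfJoin (integralCirculant N D) m) (Real.pi / 2) =
      c • (1 - Matrix.circulant (subgroupIndicator (layerMultiples m N (N / 2)))) := by
    have hrest : circulantWalk (∑ d ∈ D.erase d₀, layerGcdIndicator m N d) = 1 :=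
      circulantWalk_sum_eq_one _ _ fun d hd => circulantWalk_layerGcdIndicator_eq_one
        (hD d (Finset.mem_of_mem_erase hd) (Finset.ne_of_mem_erase hd))
    rw [quantumWalk, adjMatrix_selfJoin_integralCirculant, ← circulantWalk, circulantWalk_add,
      circulantWalk_complement_layers_eq_one ((by norm_num : 4 ∣ 8).trans hN),
      ← Finset.add_sum_erase D _ hd₀, circulantWalk_add, hrest, hW, one_mul, mul_one]
  have hne : ((N / 2 : ℕ) : ZMod N) ≠ 0 := by
    rw [Ne, ZMod.natCast_eq_zero_iff]
    intro h
    have := Nat.le_of_dvd (by omega) h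
    omega
  have hmem := AddSubgroup.mem_zmultiples ((N / 2 : ℕ) : ZMod N)
  refine ⟨Real.pi / 2, ?_, ?_⟩
  · rw [PerfectStateTransferAt, hwalk]
    simp [Matrix.circulant_apply, subgroupIndicator_apply,
      mem_layerMultiples, hc, hne, hmem]
  · rw [PerfectStateTransferAt, hwalk]
    simp [Matrix.circulant_apply, subgroupIndicator_apply,
      mem_layerMultiples, hc, hne.symm, hmem]

theorem mainTheorem11 (m n b : ℕ) [NeZero n] (hm : 1 ≤ m) (hn : n ≡ 0 [MOD 8])
    (hb : b = 1 ∨ b = 2) (Q : Finset ℕ) (hQ : ∀ q ∈ Q, Odd q ∧ q ∣ n) :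
    (∀ j : Fin m, PerfectStateTransferBetween
      (selfJoin (integralCirculant n {1, n / 2 ^ b}) m)
      (j, 0) (j, ((n / 2 : ℕ) : ZMod n))) ∧
    (∀ j : Fin m, PerfectStateTransferBetween
      (selfJoin (integralCirculant (2 * n) ({2, n / 2 ^ (b - 1)} ∪ Q)) m)
      (j, 0) (j, (n : ZMod (2 * n)))) := by
  have h8 : 8 ∣ n := (Nat.modEq_zero_iff_dvd).mp hn
  refine ⟨fun j => ?_, fun j => ?_⟩
  · refine perfectStateTransferBetween_selfJoin_integralCirculant h8
      (d₀ := n / 2 ^ b) (by simp) ?_ ?_ j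
    · rcases hb with rfl | rfl <;> norm_num <;> omega
    · intro d hd hne
      simp only [Finset.mem_insert, Finset.mem_singleton] at hd
      obtain rfl := hd.resolve_right hne
      simpa using h8
  · have h := perfectStateTransferBetween_selfJoin_integralCirculant (N := 2 * n)
      (D := {2, n / 2 ^ (b - 1)} ∪ Q) (h8.mul_left 2) (d₀ := n / 2 ^ (b - 1)) (by simp) ?_ ?_ j
    · rwa [Nat.mul_div_cancel_left n two_pos] at h
    · rcases hb with rfl | rfl <;> norm_num <;> omega
    · intro d hd hne
      simp only [Finset.mem_union, Finset.mem_insert, Finset.mem_singleton] at hd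
      rcases hd with (rfl | hd) | hd
      -- For `d = 2` the condition is `16 ∣ 2 * n`.
      · omega
      · exact absurd hd hne
      · obtain ⟨hodd, hdvd⟩ := hQ d hd
        have hcop : Nat.Coprime 8 d := Nat.Coprime.pow_left 3 hodd.coprime_two_left
        exact (hcop.mul_dvd_of_dvd_of_dvd h8 hdvd).mul_left 2
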